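/- Let $m\ge 1$ be an integer, $\delta>0$, and let $f\in C^{2m+2}([-\delta,\delta])$ have $0$ as a $(2m+1)$-fold root, i.e. $f^{(j)}(0)=0$ for $0\le j\le 2m$ and $f^{(2m+1)}(0)\neq 0$. Let $k_0\in\mathbb{R}\setminus\{-1,0,1\}$. Then there is $\varepsilon>0$ (depending on $f,\delta,m,k_0$) such that, for every real $e_0$ with $0<|e_0|<\varepsilon$, the secant iteration $$e_{n+1}=e_n-f(e_n)\,\frac{e_{n-1}-e_n}{f(e_{n-1})-f(e_n)}\qquad(n\ge 1)$$ started from $e_0$ and $e_1=k_0e_0$ is well defined, with $e_n\in[-\delta,\delta]$, $e_n\ne 0$ and $f(e_n)\ne f(e_{n+1})$ for all $n\ge 0$, and the errors $e_n$ converge Q-linearly to $0$: $e_n\to 0$ and $\lim_{n\to\infty}|e_{n+1}|/|e_n|=c$ for some $c\in(0,1)$. Moreover, if $k_0<-1$, then for all such $e_0$ the ratio $k_1=e_2/e_1$ lies in $(-1,0)$. -/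

import Mathlib

open Set Filter Topology

/-- `a` is an `m`-fold root of `f`: the derivatives of `f` at `a` of order `0, …, m - 1` vanish,
and the derivative of order `m` does not. (Used for functions that are `C^m` near `a`.) -/
def IsRootOfMultiplicity (f : ℝ → ℝ) (a : ℝ) (m : ℕ) : Prop :=
  (∀ j < m, iteratedDeriv j f a = 0) ∧ iteratedDeriv m f a ≠ 0

/-- The sequence of secant iterates of `f` with initial values `x₀`, `x₁`. The step is meaningful
where `f x_n ≠ f x_{n+1}`; this is asserted separately wherever the sequence is used. -/
noncomputable def secantSeq (f : ℝ → ℝ) (x₀ x₁ : ℝ) : ℕ → ℝ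
  | 0 => x₀
  | 1 => x₁
  | n + 2 =>
      secantSeq f x₀ x₁ (n + 1) -
        f (secantSeq f x₀ x₁ (n + 1)) *
          ((secantSeq f x₀ x₁ n - secantSeq f x₀ x₁ (n + 1)) /
            (f (secantSeq f x₀ x₁ n) - f (secantSeq f x₀ x₁ (n + 1))))

/-- The quotient `k_n = e_{n+1} / e_n` of consecutive terms. -/
noncomputable def succRatio (e : ℕ → ℝ) (n : ℕ) : ℝ := e (n + 1) / e n

/-- The sequence `x` converges to `L` with Q-order `p ≥ 1` and asymptotic error constant `c > 0`. -/
def ConvergesWithQOrder (x : ℕ → ℝ) (L p c : ℝ) : Prop :=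
  Tendsto x atTop (𝓝 L) ∧ 1 ≤ p ∧ 0 < c ∧
    Tendsto (fun n => |x (n + 1) - L| / |x n - L| ^ p) atTop (𝓝 c)

/-- Q-linear convergence: Q-order `1` with asymptotic error constant in `(0, 1)`. -/
def ConvergesQLinearly (x : ℕ → ℝ) (L : ℝ) : Prop :=
  ∃ c < 1, ConvergesWithQOrder x L 1 c

/-! Put `n = 2 * m`. Near `0`, `f x` behaves like `C * x ^ (n + 1)`, so consecutive error ratios
nearly follow `T = powerSecantMap n`, locally uniformly in the ratio away from `0` and `1`
(`tendsto_secantRatio`). Since `n` is even, `T` sends ratios below `-1` into `(-1, 0)` and nonzero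
ratios above `-1` into `(0, 1)`, so two steps suffice to reach `(0, 1)`. There a compact interval of
ratios is invariant for small errors, which forces geometric decay. With a fixed point `c` in `(0,
1)`, `|T k - c| ≤ c * |k - c|`, so the ratios obey a contraction with vanishing perturbation and
tend to `c`. -/

/-- A function with a root of multiplicity `p` at `0` is asymptotic to a multiple of `x ^ p`. -/
theorem IsRootOfMultiplicity.tendsto_div_pow {f : ℝ → ℝ} {p : ℕ} {δ : ℝ} (hδ : 0 < δ)
    (hf : ContDiffOn ℝ p f (Icc (-δ) δ)) (hroot : IsRootOfMultiplicity f 0 p) :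
    ∃ C : ℝ, C ≠ 0 ∧ Tendsto (fun x => f x / x ^ p) (𝓝[≠] 0) (𝓝 C) := by
  have h0 : (0 : ℝ) ∈ Icc (-δ) δ := ⟨by linarith, hδ.le⟩
  have hnhds : Icc (-δ) δ ∈ 𝓝 (0 : ℝ) := Icc_mem_nhds (by linarith) hδ
  have hderiv : ∀ j ≤ p, iteratedDerivWithin j f (Icc (-δ) δ) 0 = iteratedDeriv j f 0 := by
    intro j hj
    exact iteratedDerivWithin_eq_iteratedDeriv (uniqueDiffOn_Icc (by linarith))
      ((hf.of_le (by exact_mod_cast hj)).contDiffAt hnhds) h0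
  have hT := taylor_tendsto (convex_Icc (-δ) δ) h0 hf
  rw [nhdsWithin_eq_nhds.2 hnhds] at hT
  set C : ℝ := ((p.factorial : ℝ))⁻¹ * iteratedDeriv p f 0
  have heval : ∀ x, taylorWithinEval f p (Icc (-δ) δ) 0 x = C * x ^ p := by
    intro x
    rw [taylor_within_apply, Finset.sum_range_succ, Finset.sum_eq_zero, hderiv p le_rfl]
    · simp only [C, smul_eq_mul, sub_zero]; ring
    · intro j hj
      rw [hderiv j (Finset.mem_range.1 hj).le, hroot.1 j (Finset.mem_range.1 hj), smul_zero]
  refine ⟨C, mul_ne_zero (by positivity) hroot.2, ?_⟩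
  have h := (hT.mono_left (nhdsWithin_le_nhds (s := {0}ᶜ))).add_const C
  rw [zero_add] at h
  refine h.congr' ?_
  filter_upwards [self_mem_nhdsWithin] with x hx
  have hx : x ≠ 0 := hx
  rw [heval]
  simp only [sub_zero, smul_eq_mul]
  field_simp
  ring

/-! ### The limiting ratio map. -/

/-- The map taking `e_n / e_{n-1}` to `e_{n+1} / e_n` for the secant method applied to
`x ^ (n + 1)`. -/
noncomputable def powerSecantMap (n : ℕ) (k : ℝ) : ℝ :=
  (∑ i ∈ Finset.range n, k ^ i) / ∑ i ∈ Finset.range (n + 1), k ^ i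

theorem powerSecantMap_eq {n : ℕ} {k : ℝ} (hk : k ≠ 1) :
    powerSecantMap n k = (1 - k ^ n) / (1 - k ^ (n + 1)) := by
  rw [powerSecantMap, geom_sum_eq hk, geom_sum_eq hk, div_div_div_cancel_right₀ (sub_ne_zero.2 hk),
    ← neg_div_neg_eq, neg_sub, neg_sub]

theorem geom_sum_even_succ_pos {n : ℕ} (hn : Even n) (k : ℝ) :
    0 < ∑ i ∈ Finset.range (n + 1), k ^ i :=
  hn.add_one.geom_sum_pos

/-- Writing the map with geometric sums removes the singularity of the closed form at `k = 1`. -/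
theorem continuous_powerSecantMap {n : ℕ} (hn : Even n) : Continuous (powerSecantMap n) := by
  unfold powerSecantMap
  exact Continuous.div (by fun_prop) (by fun_prop) fun k => (geom_sum_even_succ_pos hn k).ne'

theorem powerSecantMap_mem_Ioo {n : ℕ} (hn : Even n) (hn0 : n ≠ 0) {k : ℝ} (hk : -1 < k)
    (hk0 : k ≠ 0) : powerSecantMap n k ∈ Ioo (0 : ℝ) 1 := by
  have h1 : 0 < ∑ i ∈ Finset.range n, k ^ i := geom_sum_pos' (by linarith) hn0
  have h2 := geom_sum_even_succ_pos hn k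
  refine ⟨div_pos h1 h2, (div_lt_one h2).2 ?_⟩
  rw [Finset.sum_range_succ]
  linarith [hn.pow_pos hk0]

theorem powerSecantMap_mem_Ioo_of_lt_neg_one {n : ℕ} (hn : Even n) (hn0 : n ≠ 0) {k : ℝ}
    (hk : k < -1) : powerSecantMap n k ∈ Ioo (-1 : ℝ) 0 := by
  have h1 : ∑ i ∈ Finset.range n, k ^ i < 0 := (geom_sum_neg_iff hn0).2 ⟨hn, by linarith⟩
  have h2 := geom_sum_even_succ_pos hn k
  refine ⟨?_, div_neg_of_neg_of_pos h1 h2⟩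
  rw [powerSecantMap, lt_div_iff₀ h2, Finset.sum_range_succ]
  have h3 := geom_sum_mul k n
  -- With `S` the sum of `n` terms, `2 * S + k ^ n = S * (k + 1) + 1`, and `S`, `k + 1` are both
  -- negative.
  nlinarith

theorem half_lt_powerSecantMap {n : ℕ} (hn0 : n ≠ 0) {k : ℝ} (hk0 : 0 ≤ k) (hk : k < 1) :
    1 / 2 < powerSecantMap n k := by
  have h2 : 0 < ∑ i ∈ Finset.range (n + 1), k ^ i := geom_sum_pos hk0 n.succ_ne_zero
  rw [powerSecantMap, lt_div_iff₀ h2, Finset.sum_range_succ]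
  have h3 : k ^ n < 1 := pow_lt_one₀ hk0 hk hn0
  have h4 : (1 : ℝ) ≤ ∑ i ∈ Finset.range n, k ^ i := by
    calc (1 : ℝ) = k ^ 0 := (pow_zero k).symm
      _ ≤ _ := Finset.single_le_sum (f := fun i => k ^ i) (fun i _ => pow_nonneg hk0 i)
        (Finset.mem_range.2 (Nat.pos_of_ne_zero hn0))
  linarith

theorem powerSecantMap_antitoneOn (n : ℕ) : AntitoneOn (powerSecantMap n) (Ici 0) := by
  intro a ha b hb hab
  have ha : 0 ≤ a := ha
  have hb : 0 ≤ b := hb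
  have h1 : 0 < ∑ i ∈ Finset.range (n + 1), a ^ i := geom_sum_pos ha n.succ_ne_zero
  have h2 : 0 < ∑ i ∈ Finset.range (n + 1), b ^ i := geom_sum_pos hb n.succ_ne_zero
  rw [powerSecantMap, powerSecantMap, div_le_div_iff₀ h2 h1, Finset.sum_range_succ,
    Finset.sum_range_succ _ n]
  have h3 : (∑ i ∈ Finset.range n, b ^ i) * a ^ n ≤ (∑ i ∈ Finset.range n, a ^ i) * b ^ n := by
    rw [Finset.sum_mul, Finset.sum_mul]
    refine Finset.sum_le_sum fun i hi => ?_
    obtain ⟨d, rfl⟩ := Nat.exists_eq_add_of_le (Finset.mem_range.1 hi).le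
    rw [pow_add, pow_add]
    have : a ^ d ≤ b ^ d := pow_le_pow_left₀ ha hab d
    calc b ^ i * (a ^ i * a ^ d) ≤ b ^ i * (a ^ i * b ^ d) := by gcongr
      _ = _ := by ring
  linarith

/-- The power secant map contracts distances by the factor `T a * T b`. -/
theorem abs_powerSecantMap_sub_le {n : ℕ} (hn0 : n ≠ 0) {a b : ℝ} (ha : 0 ≤ a) (hb : 0 ≤ b) :
    |powerSecantMap n a - powerSecantMap n b| ≤
      powerSecantMap n a * powerSecantMap n b * |a - b| := by
  wlog hab : a ≤ b generalizing a b
  · rw [abs_sub_comm, abs_sub_comm a, mul_comm (powerSecantMap n a)]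
    exact this hb ha (le_of_not_ge hab)
  have hmono := powerSecantMap_antitoneOn n ha hb hab
  rw [abs_of_nonneg (sub_nonneg.2 hmono), abs_sub_comm, abs_of_nonneg (sub_nonneg.2 hab)]
  have hA : 0 < ∑ i ∈ Finset.range n, a ^ i := geom_sum_pos ha hn0
  have hB : 0 < ∑ i ∈ Finset.range n, b ^ i := geom_sum_pos hb hn0
  have hAB : (∑ i ∈ Finset.range n, a ^ i) ≤ ∑ i ∈ Finset.range n, b ^ i :=
    Finset.sum_le_sum fun i _ => pow_le_pow_left₀ ha hab i
  -- In the form `A / (a * A + 1)`, the difference has numerator `A * B * (b - a) + (A - B)`, and `A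
  -- ≤ B`.
  simp only [powerSecantMap, geom_sum_succ (n := n)]
  set A := ∑ i ∈ Finset.range n, a ^ i
  set B := ∑ i ∈ Finset.range n, b ^ i
  rw [div_sub_div _ _ (by positivity) (by positivity), div_mul_div_comm, div_mul_eq_mul_div]
  gcongr
  nlinarith

/-! ### Asymptotics of one secant step. -/

/-- The quotient `e_{n+1} / e_n` of the secant step from `e_{n-1} = x`, `e_n = k * x`. -/
noncomputable def secantRatio (f : ℝ → ℝ) (k x : ℝ) : ℝ :=
  (k * x - f (k * x) * ((x - k * x) / (f x - f (k * x)))) / (k * x)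

theorem secantSeq_succ (f : ℝ → ℝ) (x y : ℝ) (n : ℕ) :
    secantSeq f x y (n + 1) =
      secantSeq f y (y - f y * ((x - y) / (f x - f y))) n := by
  induction n using Nat.twoStepInduction with
  | zero => simp [secantSeq]
  | one => simp [secantSeq]
  | more n h1 h2 => rw [secantSeq, h1, h2, secantSeq]

theorem tendsto_mul_nhdsNE {k : ℝ} (hk : k ≠ 0) :
    Tendsto (fun z : ℝ × ℝ => z.1 * z.2) (𝓝 k ×ˢ 𝓝[≠] 0) (𝓝[≠] 0) := by
  refine tendsto_nhdsWithin_iff.2 ⟨?_, ?_⟩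
  · have h := (tendsto_fst (f := 𝓝 k) (g := 𝓝[≠] (0 : ℝ))).mul
      (tendsto_snd.mono_right (nhdsWithin_le_nhds (a := (0 : ℝ)) (s := {0}ᶜ)))
    simpa using h
  · filter_upwards [tendsto_fst.eventually (isOpen_ne.mem_nhds hk),
      tendsto_snd.eventually self_mem_nhdsWithin] with z h1 h2
    exact mul_ne_zero h1 h2

section Asymptotic

variable {f : ℝ → ℝ} {n : ℕ} {C : ℝ}

theorem tendsto_comp_mul_div (hC : C ≠ 0)
    (hf : Tendsto (fun x => f x / x ^ (n + 1)) (𝓝[≠] 0) (𝓝 C)) {k : ℝ} (hk : k ≠ 0) :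
    Tendsto (fun z : ℝ × ℝ => f (z.1 * z.2) / f z.2) (𝓝 k ×ˢ 𝓝[≠] 0) (𝓝 (k ^ (n + 1))) := by
  have h1 := hf.comp (tendsto_mul_nhdsNE hk)
  have h2 := hf.comp (tendsto_snd (f := 𝓝 k) (g := 𝓝[≠] (0 : ℝ)))
  have h3 : Tendsto (fun z : ℝ × ℝ => z.1 ^ (n + 1)) (𝓝 k ×ˢ 𝓝[≠] (0 : ℝ)) (𝓝 (k ^ (n + 1))) :=
    tendsto_fst.pow _
  have h := (h1.div h2 hC).mul h3
  rw [div_self hC, one_mul] at h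
  refine h.congr' ?_
  filter_upwards [tendsto_fst.eventually (isOpen_ne.mem_nhds hk),
    tendsto_snd.eventually self_mem_nhdsWithin] with z hz1 hz2
  have hz1 : z.1 ≠ 0 := hz1
  have hz2 : z.2 ≠ 0 := hz2
  simp only [Function.comp, Pi.div_apply, mul_pow]
  -- If `f z.2 = 0`, both sides are `0` because division by zero gives `0`.
  by_cases hfz : f z.2 = 0
  · simp [hfz]
  · field_simp

theorem eventually_comp_ne_zero (hC : C ≠ 0)
    (hf : Tendsto (fun x => f x / x ^ (n + 1)) (𝓝[≠] 0) (𝓝 C)) : ∀ᶠ x in 𝓝[≠] 0, f x ≠ 0 := by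
  filter_upwards [hf.eventually (isOpen_ne.mem_nhds hC)] with x hx h0
  exact hx (by simp [h0])

theorem pow_succ_ne_one (hn : Even n) {k : ℝ} (hk : k ≠ 1) : k ^ (n + 1) ≠ 1 := by
  intro h
  exact hk (hn.add_one.strictMono_pow.injective (h.trans (one_pow _).symm))

theorem eventually_comp_mul_ne (hn : Even n) (hC : C ≠ 0)
    (hf : Tendsto (fun x => f x / x ^ (n + 1)) (𝓝[≠] 0) (𝓝 C)) {k : ℝ} (hk : k ≠ 0)
    (hk1 : k ≠ 1) : ∀ᶠ z : ℝ × ℝ in 𝓝 k ×ˢ 𝓝[≠] 0, f z.2 ≠ f (z.1 * z.2) := by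
  filter_upwards [(tendsto_comp_mul_div hC hf hk).eventually
      (isOpen_ne.mem_nhds (pow_succ_ne_one hn hk1)),
    tendsto_snd.eventually (eventually_comp_ne_zero hC hf)] with z h1 h2 h3
  exact h1 (by rw [← h3, div_self h2])

/-- With `q = f (k * x) / f x`, the ratio is `1 - q * ((1 - k) / (1 - q)) / k`, and `q` tends to `k
^ (n + 1)`. The limit is joint in `(k, x)`, so compactness makes it uniform in `k`. -/
theorem tendsto_secantRatio (hn : Even n) (hC : C ≠ 0)
    (hf : Tendsto (fun x => f x / x ^ (n + 1)) (𝓝[≠] 0) (𝓝 C)) {k : ℝ} (hk : k ≠ 0)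
    (hk1 : k ≠ 1) :
    Tendsto (fun z : ℝ × ℝ => secantRatio f z.1 z.2) (𝓝 k ×ˢ 𝓝[≠] 0)
      (𝓝 (powerSecantMap n k)) := by
  have hq := tendsto_comp_mul_div hC hf hk
  have hfst := tendsto_fst (f := 𝓝 k) (g := 𝓝[≠] (0 : ℝ))
  have hden : 1 - k ^ (n + 1) ≠ 0 := sub_ne_zero.2 (pow_succ_ne_one hn hk1).symm
  have h := ((hq.mul ((hfst.const_sub 1).div (hq.const_sub 1) hden)).div hfst hk).const_sub 1
  have hval : 1 - k ^ (n + 1) * ((1 - k) / (1 - k ^ (n + 1))) / k = powerSecantMap n k := by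
    rw [powerSecantMap_eq hk1]
    field_simp
    ring
  rw [hval] at h
  refine h.congr' ?_
  filter_upwards [hfst.eventually (isOpen_ne.mem_nhds hk),
    tendsto_snd.eventually self_mem_nhdsWithin,
    tendsto_snd.eventually (eventually_comp_ne_zero hC hf),
    eventually_comp_mul_ne hn hC hf hk hk1] with z h1 h2 h3 h4
  have h1 : z.1 ≠ 0 := h1
  have h2 : z.2 ≠ 0 := h2
  have h5 : f z.2 - f (z.1 * z.2) ≠ 0 := sub_ne_zero.2 h4
  have h6 : 1 - f (z.1 * z.2) / f z.2 = (f z.2 - f (z.1 * z.2)) / f z.2 := by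
    field_simp
  simp only [Pi.div_apply, secantRatio, h6]
  field_simp

end Asymptotic

/-! ### Uniformity, perturbed contractions and the fixed point. -/

theorem IsCompact.eventually_forall_of_eventually_prod {α β : Type*} [TopologicalSpace α]
    {K : Set α} (hK : IsCompact K) {l : Filter β} {P : α → β → Prop}
    (h : ∀ k ∈ K, ∀ᶠ z : α × β in 𝓝 k ×ˢ l, P z.1 z.2) : ∀ᶠ x in l, ∀ k ∈ K, P k x := by
  have h1 := hK.mem_nhdsSet_prod_of_forall (s := {z : α × β | P z.1 z.2}) h
  obtain ⟨u, hu, v, hv, huv⟩ := Filter.mem_prod_iff.1 h1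
  filter_upwards [hv] with x hx k hk
  exact huv (Set.mk_mem_prod (subset_of_mem_nhdsSet hu hk) hx)

theorem tendsto_zero_of_le_mul_add {u η : ℕ → ℝ} {q : ℝ} (hq0 : 0 ≤ q) (hq : q < 1)
    (hu : ∀ n, 0 ≤ u n) (hη : Tendsto η atTop (𝓝 0)) (h : ∀ n, u (n + 1) ≤ q * u n + η n) :
    Tendsto u atTop (𝓝 0) := by
  refine tendsto_order.2 ⟨fun c hc => Eventually.of_forall fun n => hc.trans_le (hu n),
    fun c hc => ?_⟩
  have hc' : 0 < (1 - q) * (c / 2) := mul_pos (by linarith) (by linarith)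
  obtain ⟨N, hN⟩ := eventually_atTop.1 (hη.eventually (gt_mem_nhds hc'))
  -- The level `c / 2` is preserved: `q * (c / 2) + (1 - q) * (c / 2) = c / 2`.
  have key : ∀ j, u (N + j) ≤ c / 2 + q ^ j * u N := by
    intro j
    induction j with
    | zero => simp; linarith
    | succ j ih =>
      have h1 := h (N + j)
      have h2 := hN (N + j) (Nat.le_add_right _ _)
      have h3 := mul_le_mul_of_nonneg_left ih hq0
      rw [← add_assoc, pow_succ]
      linarith
  have hlim : Tendsto (fun j : ℕ => q ^ j * u N) atTop (𝓝 0) := by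
    simpa using (tendsto_pow_atTop_nhds_zero_of_lt_one hq0 hq).mul_const (u N)
  obtain ⟨M, hM⟩ := eventually_atTop.1 (hlim.eventually (gt_mem_nhds (half_pos hc)))
  refine eventually_atTop.2 ⟨N + M, fun n hn => ?_⟩
  obtain ⟨j, rfl⟩ := Nat.exists_eq_add_of_le hn
  have h1 := key (M + j)
  have h2 := hM (M + j) (Nat.le_add_right _ _)
  rw [add_assoc]
  linarith

theorem exists_powerSecantMap_eq_self {n : ℕ} (hn : Even n) (hn0 : n ≠ 0) :
    ∃ c ∈ Ioo (0 : ℝ) 1, powerSecantMap n c = c := by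
  have h0 : powerSecantMap n 0 = 1 := by
    simp [powerSecantMap, zero_pow_eq, Finset.sum_ite_eq', Nat.pos_of_ne_zero hn0]
  have h1 := (powerSecantMap_mem_Ioo hn hn0 (k := 1) (by norm_num) one_ne_zero).2
  have hc : ContinuousOn (fun x => x - powerSecantMap n x) (Icc 0 1) :=
    (continuous_id.sub (continuous_powerSecantMap hn)).continuousOn
  obtain ⟨c, hc, hc'⟩ := intermediate_value_Ioo zero_le_one hc
    (show (0 : ℝ) ∈ Ioo _ _ from ⟨by simp [h0], by linarith⟩)
  have : c - powerSecantMap n c = 0 := hc'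
  exact ⟨c, hc, by linarith⟩

/-! ### Convergence of the iteration. -/

/-- The secant iteration from `x`, `y` is well defined in `[-δ, δ]`, avoids `0`, and converges
Q-linearly to `0`. -/
def SecantConverges (f : ℝ → ℝ) (δ x y : ℝ) : Prop :=
  (∀ n, secantSeq f x y n ∈ Icc (-δ) δ ∧ secantSeq f x y n ≠ 0 ∧
    f (secantSeq f x y n) ≠ f (secantSeq f x y (n + 1))) ∧
  ConvergesQLinearly (secantSeq f x y) 0

theorem convergesQLinearly_zero_iff {e : ℕ → ℝ} :
    ConvergesQLinearly e 0 ↔ Tendsto e atTop (𝓝 0) ∧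
      ∃ c ∈ Ioo (0 : ℝ) 1, Tendsto (fun n => |e (n + 1)| / |e n|) atTop (𝓝 c) := by
  simp only [ConvergesQLinearly, ConvergesWithQOrder, sub_zero, Real.rpow_one, le_refl, true_and,
    mem_Ioo]
  constructor
  · rintro ⟨c, h1, h2, h3, h4⟩
    exact ⟨h2, c, ⟨h3, h1⟩, h4⟩
  · rintro ⟨h2, c, ⟨h3, h1⟩, h4⟩
    exact ⟨c, h1, h2, h3, h4⟩

theorem SecantConverges.of_step {f : ℝ → ℝ} {δ x y : ℝ} (hx : x ∈ Icc (-δ) δ) (hx0 : x ≠ 0)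
    (hxy : f x ≠ f y) (h : SecantConverges f δ y (y - f y * ((x - y) / (f x - f y)))) :
    SecantConverges f δ x y := by
  obtain ⟨h1, h2⟩ := h
  rw [convergesQLinearly_zero_iff] at h2
  obtain ⟨h2, c, hc, h3⟩ := h2
  refine ⟨fun n => ?_, convergesQLinearly_zero_iff.2 ⟨?_, c, hc, ?_⟩⟩
  · cases n with
    | zero => exact ⟨hx, hx0, hxy⟩
    | succ n => simpa only [secantSeq_succ f x y] using h1 n
  · exact (tendsto_add_atTop_iff_nat 1).1 (by simpa only [secantSeq_succ f x y] using h2)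
  · exact (tendsto_add_atTop_iff_nat 1).1 (by simpa only [secantSeq_succ f x y] using h3)

section

variable {f : ℝ → ℝ} {n : ℕ} {C δ : ℝ}

theorem secantSeq_div_succ {x y : ℝ} {j : ℕ} (h : secantSeq f x y j ≠ 0) :
    secantSeq f x y (j + 2) / secantSeq f x y (j + 1) =
      secantRatio f (secantSeq f x y (j + 1) / secantSeq f x y j) (secantSeq f x y j) := by
  rw [secantRatio, div_mul_cancel₀ _ h, secantSeq]

theorem secantConverges_of_invariant (hn : Even n) (hn0 : n ≠ 0) (hC : C ≠ 0)
    (hf : Tendsto (fun x => f x / x ^ (n + 1)) (𝓝[≠] 0) (𝓝 C)) {a b ρ : ℝ} (ha : 0 < a)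
    (hb : b < 1) (hρδ : ρ ≤ δ)
    (hρ : ∀ x, x ≠ 0 → |x| < ρ → ∀ k ∈ Icc a b, f x ≠ f (k * x) ∧ secantRatio f k x ∈ Icc a b)
    {x k : ℝ} (hx0 : x ≠ 0) (hx : |x| < ρ) (hk : k ∈ Icc a b) :
    SecantConverges f δ x (k * x) := by
  set e := secantSeq f x (k * x) with he
  have hinv : ∀ j, e j ≠ 0 ∧ |e j| < ρ ∧ e (j + 1) / e j ∈ Icc a b := by
    intro j
    induction j with
    | zero =>
      refine ⟨hx0, hx, ?_⟩
      have : e (0 + 1) / e 0 = k := mul_div_cancel_right₀ k hx0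
      rwa [this]
    | succ j ih =>
      obtain ⟨h1, h2, h3⟩ := ih
      have h4 : e (j + 1) = e (j + 1) / e j * e j := (div_mul_cancel₀ _ h1).symm
      have h5 : 0 < e (j + 1) / e j := ha.trans_le h3.1
      refine ⟨?_, ?_, ?_⟩
      · rw [h4]; exact mul_ne_zero h5.ne' h1
      · rw [h4, abs_mul, abs_of_pos h5]
        exact (mul_le_of_le_one_left (abs_nonneg _) (h3.2.trans hb.le)).trans_lt h2
      · rw [he, secantSeq_div_succ h1]
        exact (hρ _ h1 h2 _ h3).2
  have hb0 : 0 ≤ b := ha.le.trans (hk.1.trans hk.2)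
  have hratio : ∀ j, |e (j + 1)| / |e j| = e (j + 1) / e j := fun j => by
    rw [← abs_div, abs_of_pos (ha.trans_le (hinv j).2.2.1)]
  have hgeom : ∀ j, |e j| ≤ b ^ j * |x| := by
    intro j
    induction j with
    | zero => rw [pow_zero, one_mul]; exact le_rfl
    | succ j ih =>
      have h1 : |e (j + 1)| = e (j + 1) / e j * |e j| := by
        rw [← hratio, div_mul_cancel₀ _ (abs_pos.2 (hinv j).1).ne']
      rw [h1, pow_succ', mul_assoc]
      exact mul_le_mul (hinv j).2.2.2 ih (abs_nonneg _) hb0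
  have hlim : Tendsto e atTop (𝓝 0) := by
    refine squeeze_zero_norm hgeom ?_
    simpa using (tendsto_pow_atTop_nhds_zero_of_lt_one hb0 hb).mul_const |x|
  have hlim' : Tendsto e atTop (𝓝[≠] 0) :=
    tendsto_nhdsWithin_iff.2 ⟨hlim, Eventually.of_forall fun j => (hinv j).1⟩
  refine ⟨fun j => ⟨abs_le.1 ((hinv j).2.1.le.trans hρδ), (hinv j).1, ?_⟩, ?_⟩
  · have h1 := (hρ _ (hinv j).1 (hinv j).2.1 _ (hinv j).2.2).1
    rwa [div_mul_cancel₀ _ (hinv j).1] at h1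
  obtain ⟨c, hc, hfix⟩ := exists_powerSecantMap_eq_self hn hn0
  refine convergesQLinearly_zero_iff.2 ⟨hlim, c, hc, ?_⟩
  refine (tendsto_congr hratio).2 ?_
  rw [tendsto_iff_dist_tendsto_zero]
  simp only [Real.dist_eq]
  -- The perturbation is the gap between the true ratio map and its limit at the current ratio.
  refine tendsto_zero_of_le_mul_add
    (η := fun j => |secantRatio f (e (j + 1) / e j) (e j) - powerSecantMap n (e (j + 1) / e j)|)
    hc.1.le hc.2 (fun j => abs_nonneg _) ?_ ?_
  · refine tendsto_order.2 ⟨fun σ hσ => Eventually.of_forall fun j => hσ.trans_le (abs_nonneg _),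
      fun σ hσ => ?_⟩
    have hunif : ∀ᶠ x in 𝓝[≠] 0, ∀ k ∈ Icc a b, |secantRatio f k x - powerSecantMap n k| < σ := by
      refine isCompact_Icc.eventually_forall_of_eventually_prod fun k hk => ?_
      have h1 := (tendsto_secantRatio hn hC hf (ha.trans_le hk.1).ne'
        (hk.2.trans_lt hb).ne).sub
        (((continuous_powerSecantMap hn).tendsto k).comp
          (tendsto_fst (f := 𝓝 k) (g := 𝓝[≠] (0 : ℝ))))
      rw [sub_self] at h1
      have h2 := h1.abs
      rw [abs_zero] at h2
      exact h2.eventually (gt_mem_nhds hσ)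
    exact (hlim'.eventually hunif).mono fun j hj => hj _ (hinv j).2.2
  · intro j
    have h0 := ha.trans_le (hinv j).2.2.1
    have h1 := abs_powerSecantMap_sub_le hn0 h0.le hc.1.le
    have h2 := powerSecantMap_mem_Ioo hn hn0 (by linarith) h0.ne'
    rw [hfix] at h1
    have h3 : powerSecantMap n (e (j + 1) / e j) * c * |e (j + 1) / e j - c| ≤
        c * |e (j + 1) / e j - c| :=
      mul_le_mul_of_nonneg_right (mul_le_of_le_one_left hc.1.le h2.2.le) (abs_nonneg _)
    have h4 : e (j + 1 + 1) / e (j + 1) = secantRatio f (e (j + 1) / e j) (e j) :=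
      secantSeq_div_succ (hinv j).1
    rw [h4]
    have h5 := abs_sub_le (secantRatio f (e (j + 1) / e j) (e j))
      (powerSecantMap n (e (j + 1) / e j)) c
    linarith

theorem eventually_secantConverges_of_mem_Ioo (hδ : 0 < δ) (hn : Even n) (hn0 : n ≠ 0)
    (hC : C ≠ 0) (hf : Tendsto (fun x => f x / x ^ (n + 1)) (𝓝[≠] 0) (𝓝 C)) {k : ℝ}
    (hk : k ∈ Ioo (0 : ℝ) 1) :
    ∀ᶠ z : ℝ × ℝ in 𝓝 k ×ˢ 𝓝[≠] 0, SecantConverges f δ z.2 (z.1 * z.2) := by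
  -- On `[a, b]` the limiting map exceeds `1 / 2 > a` and is at most its value at `a`, which is
  -- below `b`; both margins are strict and survive the perturbation.
  obtain ⟨a, ha, ha'⟩ : ∃ a, 0 < a ∧ a < min k (1 / 2) := exists_between (lt_min hk.1 (by norm_num))
  obtain ⟨hak, ha2⟩ := lt_min_iff.1 ha'
  have hTa := (powerSecantMap_mem_Ioo hn hn0 (by linarith) ha.ne').2
  obtain ⟨b, hb', hb⟩ : ∃ b, max k (powerSecantMap n a) < b ∧ b < 1 :=
    exists_between (max_lt hk.2 hTa)
  obtain ⟨hkb, hTab⟩ := max_lt_iff.1 hb'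
  have hev : ∀ᶠ x in 𝓝[≠] 0, ∀ k ∈ Icc a b, f x ≠ f (k * x) ∧ secantRatio f k x ∈ Icc a b := by
    refine isCompact_Icc.eventually_forall_of_eventually_prod fun κ hκ => ?_
    have hκ0 : 0 < κ := ha.trans_le hκ.1
    have hκ1 : κ < 1 := hκ.2.trans_lt hb
    refine (eventually_comp_mul_ne hn hC hf hκ0.ne' hκ1.ne).and
      ((tendsto_secantRatio hn hC hf hκ0.ne' hκ1.ne).eventually (Icc_mem_nhds ?_ ?_))
    · exact ha2.trans (half_lt_powerSecantMap hn0 hκ0.le hκ1)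
    · exact (powerSecantMap_antitoneOn n ha.le hκ0.le hκ.1).trans_lt hTab
  obtain ⟨ρ, hρ, hρ'⟩ := Metric.mem_nhdsWithin_iff.1 hev
  have hball : {x : ℝ | |x| < min ρ δ} ∈ 𝓝[≠] (0 : ℝ) := by
    refine mem_nhdsWithin_of_mem_nhds ((isOpen_lt continuous_abs continuous_const).mem_nhds ?_)
    simpa using ⟨hρ, hδ⟩
  filter_upwards [tendsto_fst.eventually (Icc_mem_nhds hak hkb),
    tendsto_snd.eventually self_mem_nhdsWithin, tendsto_snd.eventually hball] with z h1 h2 h3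
  refine secantConverges_of_invariant hn hn0 hC hf ha hb (min_le_right ρ δ) ?_ h2 h3 h1
  intro x hx0 hx
  exact hρ' ⟨by simpa using hx.trans_le (min_le_left _ _), hx0⟩

/-- Convergence is pulled back along one secant step, `(k, x) ↦ (secantRatio f k x, k * x)`. The new
ratio only approximates its limit, hence a full neighbourhood of ratios in the hypothesis. -/
theorem eventually_secantConverges_of_powerSecantMap (hδ : 0 < δ) (hn : Even n)
    (hC : C ≠ 0) (hf : Tendsto (fun x => f x / x ^ (n + 1)) (𝓝[≠] 0) (𝓝 C)) {k : ℝ}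
    (hk : k ≠ 0) (hk1 : k ≠ 1)
    (h : ∀ᶠ z : ℝ × ℝ in 𝓝 (powerSecantMap n k) ×ˢ 𝓝[≠] 0, SecantConverges f δ z.2 (z.1 * z.2)) :
    ∀ᶠ z : ℝ × ℝ in 𝓝 k ×ˢ 𝓝[≠] 0, SecantConverges f δ z.2 (z.1 * z.2) := by
  have hstep := (tendsto_secantRatio hn hC hf hk hk1).prodMk (tendsto_mul_nhdsNE hk)
  filter_upwards [hstep.eventually h, tendsto_snd.eventually self_mem_nhdsWithin,
    tendsto_snd.eventually (mem_nhdsWithin_of_mem_nhds (Icc_mem_nhds (neg_lt_zero.2 hδ) hδ)),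
    eventually_comp_mul_ne hn hC hf hk hk1,
    (tendsto_mul_nhdsNE hk).eventually self_mem_nhdsWithin] with z h1 h2 h3 h4 h5
  refine SecantConverges.of_step h3 h2 h4 ?_
  rwa [secantRatio, div_mul_cancel₀ _ h5] at h1

theorem eventually_secantConverges (hδ : 0 < δ) (hn : Even n) (hn0 : n ≠ 0)
    (hC : C ≠ 0) (hf : Tendsto (fun x => f x / x ^ (n + 1)) (𝓝[≠] 0) (𝓝 C)) {k : ℝ}
    (hk : k ≠ 0) (hk1 : k ≠ 1) (hkn : k ≠ -1) :
    ∀ᶠ z : ℝ × ℝ in 𝓝 k ×ˢ 𝓝[≠] 0, SecantConverges f δ z.2 (z.1 * z.2) := by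
  have key : ∀ {κ : ℝ}, κ ≠ 0 → κ ≠ 1 → -1 < κ →
      ∀ᶠ z : ℝ × ℝ in 𝓝 κ ×ˢ 𝓝[≠] 0, SecantConverges f δ z.2 (z.1 * z.2) :=
    fun h0 h1 h2 => eventually_secantConverges_of_powerSecantMap hδ hn hC hf h0 h1
      (eventually_secantConverges_of_mem_Ioo hδ hn hn0 hC hf (powerSecantMap_mem_Ioo hn hn0 h2 h0))
  rcases hkn.lt_or_gt with h | h
  · have hT := powerSecantMap_mem_Ioo_of_lt_neg_one hn hn0 h
    exact eventually_secantConverges_of_powerSecantMap hδ hn hC hf hk hk1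
      (key hT.2.ne (hT.2.trans one_pos).ne hT.1)
  · exact key hk hk1 h

end

theorem theorem4p8 (m : ℕ) (hm : 1 ≤ m) (δ : ℝ) (hδ : 0 < δ) (f : ℝ → ℝ)
    (hf : ContDiffOn ℝ ((2 * m + 2 : ℕ) : WithTop ℕ∞) f (Icc (-δ) δ))
    (hroot : IsRootOfMultiplicity f 0 (2 * m + 1))
    (k₀ : ℝ) (hk₀ : k₀ ∉ ({-1, 0, 1} : Set ℝ)) :
    ∃ ε > 0, ∀ e₀ : ℝ, e₀ ≠ 0 → |e₀| < ε →
      (∀ n, secantSeq f e₀ (k₀ * e₀) n ∈ Icc (-δ) δ ∧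
        secantSeq f e₀ (k₀ * e₀) n ≠ 0 ∧
        f (secantSeq f e₀ (k₀ * e₀) n) ≠ f (secantSeq f e₀ (k₀ * e₀) (n + 1))) ∧
      ConvergesQLinearly (secantSeq f e₀ (k₀ * e₀)) 0 ∧
      (k₀ < -1 → succRatio (secantSeq f e₀ (k₀ * e₀)) 1 ∈ Ioo (-1 : ℝ) 0) := by
  simp only [mem_insert_iff, mem_singleton_iff, not_or] at hk₀
  obtain ⟨hkn, hk0, hk1⟩ := hk₀
  have hn : Even (2 * m) := even_two_mul m
  have hn0 : 2 * m ≠ 0 := by omega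
  obtain ⟨C, hC, hfC⟩ := hroot.tendsto_div_pow hδ (hf.of_le (by exact_mod_cast Nat.le_succ _))
  have hslice : Tendsto (fun x : ℝ => (k₀, x)) (𝓝[≠] 0) (𝓝 k₀ ×ˢ 𝓝[≠] 0) :=
    tendsto_const_nhds.prodMk tendsto_id
  have hratio : ∀ᶠ x : ℝ in 𝓝[≠] 0, k₀ < -1 → secantRatio f k₀ x ∈ Ioo (-1 : ℝ) 0 := by
    by_cases h : k₀ < -1
    · have hT := powerSecantMap_mem_Ioo_of_lt_neg_one hn hn0 h
      exact (((tendsto_secantRatio hn hC hfC hk0 hk1).comp hslice).eventually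
        (Ioo_mem_nhds hT.1 hT.2)).mono fun x hx _ => hx
    · exact Eventually.of_forall fun x hx => absurd hx h
  obtain ⟨ε, hε, hεs⟩ := Metric.mem_nhdsWithin_iff.1
    ((hslice.eventually (eventually_secantConverges hδ hn hn0 hC hfC hk0 hk1 hkn)).and hratio)
  refine ⟨ε, hε, fun e₀ he₀ he₀ε => ?_⟩
  obtain ⟨⟨hwell, hlin⟩, hlast⟩ := hεs ⟨by simpa using he₀ε, he₀⟩
  -- The quotient `e₂ / e₁` unfolds definitionally to `secantRatio f k₀ e₀`.
  exact ⟨hwell, hlin, hlast⟩
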